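/- **Setting.** A seller has $n$ identical items and faces $n$ unit-demand buyers with valuations $v_1,\dots,v_n$ drawn i.i.d. from a distribution $F$ with CDF $F$ and a density $f$ that is positive exactly on an interval $[\underline v,\overline v]$, $0\le\underline v<\overline v\le\infty$. For $\lambda\in[0,1)$, $F$ is $\lambda$-regular if $\lambda v-\frac{1-F(v)}{f(v)}$ is non-decreasing on $[\underline v,\overline v]$. The buyers are partitioned among intermediaries; in the *competition* case every buyer represents herself, in the *monopsony* case one intermediary represents all buyers. An intermediary that represents the set $S$ of buyers and gets $x$ items for a total payment $p$ has utility $\max\{\sum_{i\in S}v_iz_i : z\in[0,1]^S,\ \sum_{i\in S} z_i\le x\}-p$, where it knows the valuations of its own buyers. For a direct (possibly randomized) mechanism with non-negative payments, its revenue is the expected total payment under truthful reports; $\mathrm{Rev}^C$ and $\mathrm{Rev}^M$ denote the supremum of the revenue over all feasible, Bayesian incentive compatible and interim individually rational direct mechanisms (selling at most $n$ items) in the competition and the monopsony case. For $\varepsilon>0$ the bundle mechanism $B_\varepsilon$ offers all $n$ items as one bundle at the posted price $p_B^\varepsilon=n(\mathbb E[v]-\varepsilon)$, and sells it to one intermediary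 whose surplus from the $n$ items is at least this price (the first one in a fixed order), if there is one. Its revenue in the two cases is denoted $\mathrm{Rev}^C(B_\varepsilon)$ and $\mathrm{Rev}^M(B_\varepsilon)$; all these quantities depend on $F$ and $n$. **Proposition.** For every $\lambda\in[0,1)$, every $\gamma>0$ and every $\varepsilon_0>0$ there is a $\lambda$-regular distribution $F$ with finite moments of all orders and $\mathbb E[v]>\varepsilon_0$ such that 1. the bundle mechanism is asymptotically optimal for the monopsony as $n\to\infty$ and $\varepsilon\to0$: for all $n\ge1$ and $0<\varepsilon<\mathbb E[v]$, $B_\varepsilon$ is feasible, incentive compatible and individually rational in the monopsony case, and for every $\delta>0$ there is $\varepsilon_1>0$ such that for every $\varepsilon\in(0,\varepsilon_1)$ and all sufficiently large $n$, $\mathrm{Rev}^M(B_\varepsilon)\ge(1-\delta)\,\mathrm{Rev}^M$; 2. for every $\varepsilon\in(0,\varepsilon_0]$ and every $n\ge2$, $\ \mathrm{Rev}^C(B_\varepsilon)<\gamma\,\mathrm{Rev}^C$; 3. for every $\varepsilon\in(0,\mathbb E[v])$ and all sufficiently large $n$, $\ \mathrm{Rev}^C(B_\varepsilon)<\gamma\,\mathrm{Rev}^C$.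 -/

import Mathlib

open MeasureTheory Set

noncomputable section

/-- A distribution of valuations on `ℝ₊`: it has a density which is positive exactly on the
interval `[lo, hi]`, where `0 ≤ lo < hi ≤ ∞`. -/
structure ValueDistribution where
  lo : ℝ
  hi : EReal
  pdf : ℝ → ℝ
  lo_nonneg : 0 ≤ lo
  lo_lt_hi : (lo : EReal) < hi
  pdf_measurable : Measurable pdf
  pdf_pos : ∀ v : ℝ, lo ≤ v → (v : EReal) ≤ hi → 0 < pdf v
  pdf_eq_zero : ∀ v : ℝ, ¬ (lo ≤ v ∧ (v : EReal) ≤ hi) → pdf v = 0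
  lintegral_pdf : ∫⁻ v, ENNReal.ofReal (pdf v) = 1

namespace ValueDistribution

variable (F : ValueDistribution)

/-- The interval `[lo, hi]` of possible valuations. -/
def types : Set ℝ := {v | F.lo ≤ v ∧ (v : EReal) ≤ F.hi}

/-- The law of a single valuation. -/
def law : Measure ℝ := volume.withDensity (fun v => ENNReal.ofReal (F.pdf v))

instance : IsProbabilityMeasure F.law :=
  ⟨by simp [law, F.lintegral_pdf]⟩

/-- The joint law of the valuations of `n` buyers, which are i.i.d. -/
def profileLaw (n : ℕ) : Measure (Fin n → ℝ) := Measure.pi (fun _ => F.law)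

/-- The expected valuation `E[v]`. -/
def mean : ℝ := ∫ v, v ∂F.law

/-- `lam`-regularity: `lam * v - (1 - F(v)) / f(v)` is non-decreasing on the support.
For `lam = 0` this is the monotone hazard rate condition, for `lam = 1` Myerson regularity. -/
def IsRegular (lam : ℝ) : Prop :=
  MonotoneOn (fun v => lam * v - (1 - ProbabilityTheory.cdf F.law v) / F.pdf v) F.types

end ValueDistribution

/-- A demand structure: a partition of the `n` buyers into `m` nonempty groups; buyer `i` is
represented by the intermediary `rep i`. -/
structure DemandStructure (n m : ℕ) where
  rep : Fin n → Fin m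
  rep_surjective : Function.Surjective rep

/-- Full competition: every buyer represents herself. -/
def competition (n : ℕ) : DemandStructure n n := ⟨id, Function.surjective_id⟩

/-- Monopsony: one intermediary represents all the buyers. -/
def monopsony (n : ℕ) (hn : 0 < n) : DemandStructure n 1 :=
  ⟨fun _ => 0, fun _ => ⟨⟨0, hn⟩, Subsingleton.elim _ _⟩⟩

/-- The highest surplus that the buyers in `S`, with unit demand and valuations `v`, can generate
out of `x` items bought for the total price `p`. -/
def surplus {n : ℕ} (S : Finset (Fin n)) (x : ℕ) (p : ℝ) (v : Fin n → ℝ) : ℝ :=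
  sSup {u | ∃ z : Fin n → ℝ, (∀ i, 0 ≤ z i ∧ z i ≤ 1) ∧ ∑ i ∈ S, z i ≤ (x : ℝ) ∧
    u = ∑ i ∈ S, v i * z i - p}

/-- A direct mechanism selling `k` identical items to `m` intermediaries representing `n` buyers.
At the reported profile `v`, the numbers of items given to the intermediaries are `a` with
probability `alloc v a`, and intermediary `l` pays `price v l`. -/
structure Mechanism (n m k : ℕ) where
  alloc : (Fin n → ℝ) → (Fin m → Fin (k + 1)) → ℝ
  price : (Fin n → ℝ) → Fin m → ℝ

namespace DemandStructure

variable {n m k : ℕ} (D : DemandStructure n m)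

/-- The set of buyers represented by intermediary `l`. -/
def group (l : Fin m) : Finset (Fin n) := Finset.univ.filter (fun i => D.rep i = l)

/-- The profile which agrees with `v` on the buyers of `l` and with `w` on all other buyers. -/
def splice (l : Fin m) (v w : Fin n → ℝ) : Fin n → ℝ :=
  fun i => if D.rep i = l then v i else w i

/-- Expected utility of the surplus-maximizing intermediary `l` (complete information about its
buyers, full bargaining power) whose buyers have the valuations `v`, when it reports `v'` and all
other intermediaries report truthfully. Only the coordinates in the group of `l` of `v` and `v'`
matter; the valuations are independent, so conditioning on those of the group of `l` amounts to
averaging over the other coordinates. -/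
def interimUtility (F : ValueDistribution) (M : Mechanism n m k) (l : Fin m)
    (v v' : Fin n → ℝ) : ℝ :=
  ∫ w, ∑ a : Fin m → Fin (k + 1), M.alloc (D.splice l v' w) a *
    surplus (D.group l) (a l : ℕ) (M.price (D.splice l v' w) l) v ∂(F.profileLaw n)

end DemandStructure

/-- `M` is a feasible, individually rational, Bayesian incentive compatible direct mechanism.
Interim payments are required to be finite; for truthful reports this is forced by individual
rationality, and it ensures that the interim utilities are genuine expectations. -/
structure IsBIC {n m k : ℕ} (F : ValueDistribution) (D : DemandStructure n m)
    (M : Mechanism n m k) : Prop where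
  alloc_measurable : ∀ a, Measurable (fun v => M.alloc v a)
  price_measurable : ∀ l, Measurable (fun v => M.price v l)
  alloc_nonneg : ∀ v, (∀ i, v i ∈ F.types) → ∀ a, 0 ≤ M.alloc v a
  alloc_sum : ∀ v, (∀ i, v i ∈ F.types) → ∑ a, M.alloc v a = 1
  price_nonneg : ∀ v, (∀ i, v i ∈ F.types) → ∀ l, 0 ≤ M.price v l
  supply : ∀ᵐ v ∂(F.profileLaw n), ∀ a, M.alloc v a ≠ 0 → ∑ l, (a l : ℕ) ≤ k
  price_integrable : ∀ l v, (∀ i, v i ∈ F.types) →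
    Integrable (fun w => M.price (D.splice l v w) l) (F.profileLaw n)
  incentive_compatible : ∀ l v v', (∀ i, v i ∈ F.types) → (∀ i, v' i ∈ F.types) →
    D.interimUtility F M l v v' ≤ D.interimUtility F M l v v
  individually_rational : ∀ l v, (∀ i, v i ∈ F.types) → 0 ≤ D.interimUtility F M l v v

/-- The seller's expected revenue from the mechanism `M` under truthful reports. -/
def revenue {n m k : ℕ} (F : ValueDistribution) (M : Mechanism n m k) : ENNReal :=
  ∫⁻ v, ∑ l, ENNReal.ofReal (M.price v l) ∂(F.profileLaw n)

/-- The optimal expected revenue from `k` items under the demand structure `D`. -/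
def optimalRevenue {n m : ℕ} (F : ValueDistribution) (D : DemandStructure n m) (k : ℕ) :
    ENNReal :=
  ⨆ (M : Mechanism n m k) (_ : IsBIC F D M), revenue F M

/-- Intermediary `l` is the first one that is willing to buy the bundle of all `k` items for the
price `p`. -/
def buysBundle {n m : ℕ} (D : DemandStructure n m) (k : ℕ) (p : ℝ) (v : Fin n → ℝ)
    (l : Fin m) : Prop :=
  0 ≤ surplus (D.group l) k p v ∧ ∀ l' < l, surplus (D.group l') k p v < 0

open Classical in
/-- Pure bundling: all `k` items are sold as one bundle at the posted price `p`, to the first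
intermediary that is willing to buy it, if there is one; all others get and pay nothing. -/
def bundleMechanism {n m : ℕ} (D : DemandStructure n m) (k : ℕ) (p : ℝ) : Mechanism n m k where
  alloc v a := if a = (fun l => if buysBundle D k p v l then Fin.last k else 0) then 1 else 0
  price v l := if buysBundle D k p v l then p else 0

/-- The bundle price `n (E[v] - ε)`. -/
def bundlePrice (F : ValueDistribution) (n : ℕ) (ε : ℝ) : ℝ := n * (F.mean - ε)

/-- Facing a monopsony with as many items as buyers, selling all items as one bundle at the price
`n (E[v] - ε)` is asymptotically optimal as `n → ∞` and `ε → 0`: it is an admissible mechanism,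
and it gets the fraction `1 - δ` of the optimal revenue when `ε` is small and then `n` is large. -/
def BundleAsymptoticallyOptimal (F : ValueDistribution) : Prop :=
  (∀ ε ∈ Ioo 0 F.mean, ∀ (n : ℕ) (hn : 0 < n),
    IsBIC F (monopsony n hn) (bundleMechanism (monopsony n hn) n (bundlePrice F n ε))) ∧
  ∀ δ > 0, ∃ ε₁ > 0, ∀ ε ∈ Ioo 0 ε₁, ∃ N : ℕ, ∀ (n : ℕ) (hn : 0 < n), N ≤ n →
    ENNReal.ofReal (1 - δ) * optimalRevenue F (monopsony n hn) n ≤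
      revenue F (bundleMechanism (monopsony n hn) n (bundlePrice F n ε))

end

/-! ### The surplus of an intermediary -/

/-! The witness is the exponential distribution of rate one shifted by a large `s`. Its inverse
hazard rate is constantly 1, so it is regular for every `lam ≥ 0`, and all its moments are finite.

A monopsony values the bundle at the sum of the valuations. By Chebyshev this sum exceeds `n (E[v] -
ε)` with probability close to 1, while individual rationality caps every mechanism at `n E[v]` in
expectation (`bundleAsymptoticallyOptimal`).

A competing buyer can use only one item, so the bundle is worth just her own valuation to her. At a
price `p ≥ 2 (s - ε₀)` the union bound limits the revenue to `n p exp (s - p) ≤ 2 n exp ε₀`, which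
does not grow with `s`. Posting the lowest valuation earns `n s`, so a large `s` makes the ratio
smaller than `γ` (`shiftedExp_revenue_bundle_lt`). -/

theorem mul_le_max_zero {a z : ℝ} (h0 : 0 ≤ z) (h1 : z ≤ 1) : a * z ≤ max a 0 := by
  rcases le_total 0 a with ha | ha
  · exact (mul_le_of_le_one_right ha h1).trans (le_max_left _ _)
  · exact (mul_nonpos_of_nonpos_of_nonneg ha h0).trans (le_max_right _ _)

theorem surplus_le {n : ℕ} (S : Finset (Fin n)) (x : ℕ) (p : ℝ) (v : Fin n → ℝ) :
    surplus S x p v ≤ ∑ i ∈ S, max (v i) 0 - p := by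
  refine csSup_le ⟨_, fun _ => 0, fun _ => ⟨le_rfl, zero_le_one⟩, by simp, rfl⟩ ?_
  rintro u ⟨z, hz, -, rfl⟩
  gcongr with i
  exact mul_le_max_zero (hz i).1 (hz i).2

/-- The supply constraint does not bind, so the maximization separates over buyers: serve exactly
those with non-negative valuation. Positive parts appear because the profile is an arbitrary real
vector. -/
theorem surplus_eq_of_card_le {n : ℕ} {S : Finset (Fin n)} {x : ℕ} (h : S.card ≤ x) (p : ℝ)
    (v : Fin n → ℝ) : surplus S x p v = ∑ i ∈ S, max (v i) 0 - p := by
  refine (surplus_le S x p v).antisymm (le_csSup ⟨∑ i ∈ S, max (v i) 0 - p, ?_⟩ ?_)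
  · rintro u ⟨z, hz, -, rfl⟩
    gcongr with i
    exact mul_le_max_zero (hz i).1 (hz i).2
  · refine ⟨fun i => if 0 ≤ v i then 1 else 0, fun i => by dsimp only; split_ifs <;> simp, ?_, ?_⟩
    · calc ∑ i ∈ S, (if 0 ≤ v i then (1 : ℝ) else 0) ≤ ∑ i ∈ S, 1 :=
            Finset.sum_le_sum fun i _ => by split_ifs <;> simp
        _ ≤ x := by simpa using h
    · congr 1
      refine Finset.sum_congr rfl fun i _ => ?_
      dsimp only
      split_ifs with hi
      · simp [hi]
      · simp [(not_le.mp hi).le]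

theorem surplus_zero_items {n : ℕ} (S : Finset (Fin n)) (p : ℝ) (v : Fin n → ℝ) :
    surplus S 0 p v = -p := by
  have : {u | ∃ z : Fin n → ℝ, (∀ i, 0 ≤ z i ∧ z i ≤ 1) ∧ ∑ i ∈ S, z i ≤ ((0 : ℕ) : ℝ) ∧
      u = ∑ i ∈ S, v i * z i - p} = {-p} := by
    ext u
    constructor
    · rintro ⟨z, hz, hs, rfl⟩
      have h0 : ∀ i ∈ S, z i = 0 := (Finset.sum_eq_zero_iff_of_nonneg fun i _ => (hz i).1).mp
        (le_antisymm (by simpa using hs) (Finset.sum_nonneg fun i _ => (hz i).1))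
      have h1 : ∑ i ∈ S, v i * z i = 0 := Finset.sum_eq_zero fun i hi => by rw [h0 i hi, mul_zero]
      simp [h1]
    · rintro rfl
      exact ⟨fun _ => 0, fun _ => ⟨le_rfl, zero_le_one⟩, by simp, by simp⟩
  rw [surplus, this, csSup_singleton]

/-! ### Profiles of valuations -/

namespace ValueDistribution

variable (F : ValueDistribution)

theorem nonneg_of_mem_types {v : ℝ} (hv : v ∈ F.types) : 0 ≤ v := F.lo_nonneg.trans hv.1

theorem ae_mem_types : ∀ᵐ v ∂F.law, v ∈ F.types := by
  rw [law, ae_withDensity_iff F.pdf_measurable.ennreal_ofReal]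
  refine Filter.Eventually.of_forall fun v hv => ?_
  by_contra h
  exact hv (by simp [F.pdf_eq_zero v h])

instance (n : ℕ) : IsProbabilityMeasure (F.profileLaw n) := by
  unfold profileLaw; infer_instance

theorem measurePreserving_eval_profileLaw {n : ℕ} (i : Fin n) :
    MeasurePreserving (fun v : Fin n → ℝ => v i) (F.profileLaw n) F.law :=
  measurePreserving_eval (fun _ : Fin n => F.law) i

theorem ae_profile_mem_types (n : ℕ) : ∀ᵐ v ∂F.profileLaw n, ∀ i, v i ∈ F.types :=
  ae_all_iff.mpr fun i =>
    (F.measurePreserving_eval_profileLaw i).quasiMeasurePreserving.ae F.ae_mem_types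

theorem lo_le_mean (h : Integrable (fun v : ℝ => v) F.law) : F.lo ≤ F.mean := by
  calc F.lo = ∫ _, F.lo ∂F.law := by simp
    _ ≤ F.mean := integral_mono_ae (integrable_const _) h (F.ae_mem_types.mono fun v hv => hv.1)

theorem memLp_two_of_integrable_sq (h : Integrable (fun v : ℝ => v ^ 2) F.law) :
    MemLp (fun v : ℝ => v) 2 F.law :=
  (memLp_two_iff_integrable_sq measurable_id.aestronglyMeasurable).mpr h

theorem integrable_eval {n : ℕ} (h : Integrable (fun v : ℝ => v) F.law) (i : Fin n) :
    Integrable (fun v : Fin n → ℝ => v i) (F.profileLaw n) :=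
  (F.measurePreserving_eval_profileLaw i).integrable_comp_of_integrable h

theorem integral_sum_profile (n : ℕ) (h : Integrable (fun v : ℝ => v) F.law) :
    ∫ v, ∑ i, v i ∂F.profileLaw n = n * F.mean := by
  rw [integral_finsetSum _ fun i _ => F.integrable_eval h i]
  have (i : Fin n) : ∫ v, v i ∂F.profileLaw n = F.mean := by
    rw [mean, ← (F.measurePreserving_eval_profileLaw i).map_eq]
    exact (integral_map (F.measurePreserving_eval_profileLaw i).measurable.aemeasurable
      measurable_id.aestronglyMeasurable).symm
  simp [this]

/-- Chebyshev's inequality for the sum of the valuations. -/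
theorem profileLaw_sum_lt_le {n : ℕ} (hn : 0 < n) (h : Integrable (fun v : ℝ => v ^ 2) F.law)
    {ε : ℝ} (hε : 0 < ε) :
    F.profileLaw n {v | ∑ i, v i < bundlePrice F n ε} ≤
      ENNReal.ofReal (ProbabilityTheory.variance (fun v : ℝ => v) F.law / (n * ε ^ 2)) := by
  have hL := F.memLp_two_of_integrable_sq h
  have hn' : (0 : ℝ) < n := by exact_mod_cast hn
  have hS : MemLp (∑ i : Fin n, fun v : Fin n → ℝ => v i) 2 (F.profileLaw n) :=
    memLp_finsetSum' _ fun i _ => hL.comp_measurePreserving (F.measurePreserving_eval_profileLaw i)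
  have hV : ProbabilityTheory.variance (∑ i : Fin n, fun v : Fin n → ℝ => v i) (F.profileLaw n) =
      n * ProbabilityTheory.variance (fun v : ℝ => v) F.law := by
    rw [profileLaw, ProbabilityTheory.variance_sum_pi (μ := fun _ : Fin n => F.law)
      (X := fun _ v => v) fun _ => hL]
    simp
  have hM : ∫ v, (∑ i : Fin n, fun v : Fin n → ℝ => v i) v ∂F.profileLaw n = n * F.mean := by
    simpa using F.integral_sum_profile n (hL.integrable one_le_two)
  have := ProbabilityTheory.meas_ge_le_variance_div_sq hS (mul_pos hn' hε)
  rw [hV, hM] at this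
  calc _ ≤ _ := measure_mono fun v hv => ?_
    _ ≤ _ := this
    _ = _ := by congr 1; field_simp
  simp only [mem_ofPred_eq, bundlePrice, Finset.sum_apply] at hv ⊢
  rw [abs_sub_comm]
  exact le_trans (by linarith) (le_abs_self _)

end ValueDistribution

/-! ### Selling the bundle to a monopsony -/

theorem monopsony_group {n : ℕ} (hn : 0 < n) (l : Fin 1) :
    (monopsony n hn).group l = Finset.univ := by
  ext i
  simp [DemandStructure.group, eq_iff_true_of_subsingleton]

theorem monopsony_splice {n : ℕ} (hn : 0 < n) (l : Fin 1) (v w : Fin n → ℝ) :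
    (monopsony n hn).splice l v w = v := by
  ext i
  simp [DemandStructure.splice, eq_iff_true_of_subsingleton]

/-- There are no other intermediaries to average over, so the interim expectation is the integral of
a constant. -/
theorem interimUtility_monopsony (F : ValueDistribution) {n k : ℕ} (hn : 0 < n)
    (M : Mechanism n 1 k) (l : Fin 1) (v v' : Fin n → ℝ) :
    (monopsony n hn).interimUtility F M l v v' =
      ∑ a, M.alloc v' a * surplus Finset.univ (a l : ℕ) (M.price v' l) v := by
  simp [DemandStructure.interimUtility, monopsony_splice, monopsony_group]

theorem buysBundle_monopsony_iff {n : ℕ} (hn : 0 < n) (p : ℝ) (v : Fin n → ℝ) (l : Fin 1) :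
    buysBundle (monopsony n hn) n p v l ↔ p ≤ ∑ i, max (v i) 0 := by
  rw [buysBundle, monopsony_group, surplus_eq_of_card_le (by simp)]
  simp [Subsingleton.elim l 0]

/-- With enough items for everyone the supremum in `surplus` is a finite sum of positive parts,
which is visibly measurable. -/
theorem measurableSet_buysBundle {n m k : ℕ} (D : DemandStructure n m) (hk : n ≤ k) (p : ℝ)
    (l : Fin m) : MeasurableSet {v | buysBundle D k p v l} := by
  have hS (l : Fin m) : Measurable fun v => surplus (D.group l) k p v := by
    have : (fun v => surplus (D.group l) k p v) =
        fun v => ∑ i ∈ D.group l, max (v i) 0 - p :=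
      funext fun v => surplus_eq_of_card_le
        ((Finset.card_le_univ _).trans (by simpa using hk)) p v
    rw [this]
    fun_prop
  have hE : {v | buysBundle D k p v l} = {v | 0 ≤ surplus (D.group l) k p v} ∩
      ⋂ l', ⋂ _ : l' < l, {v | surplus (D.group l') k p v < 0} := by
    ext v
    simp [buysBundle]
  rw [hE]
  refine (measurableSet_le measurable_const (hS l)).inter (MeasurableSet.iInter fun l' => ?_)
  exact MeasurableSet.iInter fun _ => measurableSet_lt (hS l') measurable_const

theorem interimUtility_bundle_monopsony (F : ValueDistribution) {n : ℕ} (hn : 0 < n) (p : ℝ)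
    (l : Fin 1) (v v' : Fin n → ℝ) :
    (monopsony n hn).interimUtility F (bundleMechanism (monopsony n hn) n p) l v v' =
      if p ≤ ∑ i, max (v' i) 0 then ∑ i, max (v i) 0 - p else 0 := by
  rw [interimUtility_monopsony]
  simp only [bundleMechanism, buysBundle_monopsony_iff, ite_mul, one_mul, zero_mul,
    Finset.sum_ite_eq', Finset.mem_univ, if_true]
  split_ifs
  · rw [Fin.val_last, surplus_eq_of_card_le (by simp)]
  · simp [surplus_zero_items]

theorem isBIC_bundle_monopsony (F : ValueDistribution) {n : ℕ} (hn : 0 < n) {p : ℝ}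
    (hp : 0 ≤ p) : IsBIC F (monopsony n hn) (bundleMechanism (monopsony n hn) n p) where
  alloc_measurable a := by
    classical
    have hg : Measurable fun v : Fin n → ℝ => fun l : Fin 1 =>
        if buysBundle (monopsony n hn) n p v l then Fin.last n else 0 :=
      measurable_pi_lambda _ fun l => Measurable.ite (measurableSet_buysBundle _ le_rfl p l)
        measurable_const measurable_const
    exact Measurable.ite (measurableSet_eq_fun measurable_const hg) measurable_const measurable_const
  price_measurable l := Measurable.ite (measurableSet_buysBundle _ le_rfl p l)
    measurable_const measurable_const
  alloc_nonneg v _ a := by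
    dsimp only [bundleMechanism]
    split_ifs <;> simp
  alloc_sum v _ := by simp [bundleMechanism]
  price_nonneg v _ l := by
    dsimp only [bundleMechanism]
    split_ifs
    · exact hp
    · exact le_rfl
  supply := by
    refine Filter.Eventually.of_forall fun v a _ => ?_
    simpa using Fin.is_le (a 0)
  price_integrable l v _ := by
    simp only [monopsony_splice]
    exact integrable_const _
  -- Truth yields the positive part of the surplus; any report yields that surplus or 0.
  incentive_compatible l v v' _ _ := by
    simp only [interimUtility_bundle_monopsony]
    split_ifs <;> linarith
  individually_rational l v _ := by
    rw [interimUtility_bundle_monopsony]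
    split_ifs <;> linarith

/-- A monopsony never pays more than the sum of the valuations of its buyers. -/
theorem price_le_of_isBIC_monopsony {F : ValueDistribution} {n k : ℕ} {hn : 0 < n}
    {M : Mechanism n 1 k} (hM : IsBIC F (monopsony n hn) M) {v : Fin n → ℝ}
    (hv : ∀ i, v i ∈ F.types) (l : Fin 1) : M.price v l ≤ ∑ i, v i := by
  have h0 := hM.individually_rational l v hv
  rw [interimUtility_monopsony] at h0
  have h1 : ∑ a, M.alloc v a * surplus Finset.univ (a l : ℕ) (M.price v l) v ≤
      ∑ a, M.alloc v a * (∑ i, v i - M.price v l) := by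
    refine Finset.sum_le_sum fun a _ => mul_le_mul_of_nonneg_left ?_ (hM.alloc_nonneg v hv a)
    refine (surplus_le _ _ _ _).trans_eq ?_
    congr 1
    exact Finset.sum_congr rfl fun i _ => max_eq_left (F.nonneg_of_mem_types (hv i))
  rw [← Finset.sum_mul, hM.alloc_sum v hv, one_mul] at h1
  linarith

theorem optimalRevenue_monopsony_le (F : ValueDistribution)
    (h : Integrable (fun v : ℝ => v) F.law) {n : ℕ} (hn : 0 < n) (k : ℕ) :
    optimalRevenue F (monopsony n hn) k ≤ ENNReal.ofReal (n * F.mean) := by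
  refine iSup₂_le fun M hM => ?_
  rw [← F.integral_sum_profile n h, ofReal_integral_eq_lintegral_ofReal
    (integrable_finsetSum _ fun i _ => F.integrable_eval h i)
    ((F.ae_profile_mem_types n).mono fun v hv =>
      Finset.sum_nonneg fun i _ => F.nonneg_of_mem_types (hv i))]
  refine lintegral_mono_ae ((F.ae_profile_mem_types n).mono fun v hv => ?_)
  simpa using ENNReal.ofReal_le_ofReal (price_le_of_isBIC_monopsony hM hv 0)

theorem le_revenue_bundle_monopsony (F : ValueDistribution) {n : ℕ} (hn : 0 < n) (p : ℝ) :
    ENNReal.ofReal p * F.profileLaw n {v | p ≤ ∑ i, v i} ≤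
      revenue F (bundleMechanism (monopsony n hn) n p) := by
  rw [← lintegral_indicator_const (measurableSet_le measurable_const (by fun_prop))]
  refine lintegral_mono fun v => indicator_apply_le' (fun hv => ?_) fun _ => zero_le
  have : p ≤ ∑ i, max (v i) 0 := le_trans hv (Finset.sum_le_sum fun i _ => le_max_left _ _)
  simp [bundleMechanism, buysBundle_monopsony_iff, this]

/-- Bundling is asymptotically optimal for a monopsony as soon as the valuations have a finite
second moment and a positive mean. -/
theorem bundleAsymptoticallyOptimal (F : ValueDistribution)
    (h1 : Integrable (fun v : ℝ => v) F.law) (h2 : Integrable (fun v : ℝ => v ^ 2) F.law)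
    (hμ : 0 < F.mean) : BundleAsymptoticallyOptimal F := by
  refine ⟨fun ε hε n hn => isBIC_bundle_monopsony F hn
    (mul_nonneg n.cast_nonneg (sub_nonneg.mpr hε.2.le)), fun δ hδ => ?_⟩
  -- The loss `δ` is split evenly: the discount `ε` costs at most a fraction `δ / 2` of the mean,
  -- and `N` keeps the Chebyshev failure probability below `δ / 2`. Then `(1 - δ / 2) ^ 2 ≥ 1 - δ`.
  refine ⟨δ / 2 * F.mean, by positivity, fun ε hε => ?_⟩
  set V := ProbabilityTheory.variance (fun v : ℝ => v) F.law
  have hε0 : 0 < ε := hε.1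
  obtain ⟨N, hN⟩ := exists_nat_ge (V / (ε ^ 2 * (δ / 2)))
  refine ⟨N, fun n hn hNn => ?_⟩
  rcases le_or_gt 1 δ with hδ1 | hδ1
  · simp [ENNReal.ofReal_of_nonpos (sub_nonpos.mpr hδ1)]
  have hn' : (0 : ℝ) < n := by exact_mod_cast hn
  have hVn : V / (n * ε ^ 2) ≤ δ / 2 := by
    have : V / (ε ^ 2 * (δ / 2)) ≤ n := hN.trans (by exact_mod_cast hNn)
    rw [div_le_iff₀ (by positivity)] at this ⊢
    linarith
  have hP : ENNReal.ofReal (1 - δ / 2) ≤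
      F.profileLaw n {v | bundlePrice F n ε ≤ ∑ i, v i} := by
    have hc : {v : Fin n → ℝ | bundlePrice F n ε ≤ ∑ i, v i} =
        {v | ∑ i, v i < bundlePrice F n ε}ᶜ := by ext; simp
    rw [hc, prob_compl_eq_one_sub (measurableSet_lt (by fun_prop) measurable_const),
      ENNReal.ofReal_sub _ (by positivity), ENNReal.ofReal_one]
    exact tsub_le_tsub_left ((F.profileLaw_sum_lt_le hn h2 hε0).trans
      (ENNReal.ofReal_le_ofReal hVn)) _
  calc ENNReal.ofReal (1 - δ) * optimalRevenue F (monopsony n hn) n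
      ≤ ENNReal.ofReal (1 - δ) * ENNReal.ofReal (n * F.mean) := by
        gcongr; exact optimalRevenue_monopsony_le F h1 hn n
    _ = ENNReal.ofReal ((1 - δ) * (n * F.mean)) :=
        (ENNReal.ofReal_mul (by linarith)).symm
    _ ≤ ENNReal.ofReal (bundlePrice F n ε * (1 - δ / 2)) := by
        refine ENNReal.ofReal_le_ofReal ?_
        have h3 : (1 - δ / 2) * F.mean ≤ F.mean - ε := by linarith [hε.2]
        have h4 : (1 - δ) * F.mean ≤ (1 - δ / 2) * F.mean * (1 - δ / 2) := by
          nlinarith [mul_nonneg hμ.le (sq_nonneg δ)]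
        calc (1 - δ) * (n * F.mean) = n * ((1 - δ) * F.mean) := by ring
          _ ≤ n * ((F.mean - ε) * (1 - δ / 2)) := by
            exact mul_le_mul_of_nonneg_left
              (h4.trans (mul_le_mul_of_nonneg_right h3 (by linarith))) hn'.le
          _ = _ := by rw [bundlePrice]; ring
    _ = ENNReal.ofReal (bundlePrice F n ε) * ENNReal.ofReal (1 - δ / 2) :=
        ENNReal.ofReal_mul' (by linarith)
    _ ≤ _ := by gcongr
    _ ≤ _ := le_revenue_bundle_monopsony F hn _

/-! ### Full competition -/

theorem competition_group {n : ℕ} (l : Fin n) : (competition n).group l = {l} := by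
  ext i
  rw [DemandStructure.group, Finset.mem_filter, Finset.mem_singleton]
  simp [competition]

/-- The mechanism which sells one item to every intermediary, at the posted price `p`. -/
noncomputable def postedPrice (n : ℕ) (p : ℝ) : Mechanism n n n where
  alloc _ a := if a = (fun l => ⟨1, Nat.succ_lt_succ l.pos⟩) then 1 else 0
  price _ _ := p

theorem interimUtility_postedPrice (F : ValueDistribution) {n : ℕ} (p : ℝ) (l : Fin n)
    (v v' : Fin n → ℝ) :
    (competition n).interimUtility F (postedPrice n p) l v v' = max (v l) 0 - p := by
  simp only [DemandStructure.interimUtility, competition_group, postedPrice, ite_mul, one_mul,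
    zero_mul, Finset.sum_ite_eq', Finset.mem_univ, if_true]
  rw [surplus_eq_of_card_le (by simp)]
  simp

/-- The outcome ignores the reports, and no type is below `F.lo`, so nobody loses by buying. -/
theorem isBIC_postedPrice_lo (F : ValueDistribution) (n : ℕ) :
    IsBIC F (competition n) (postedPrice n F.lo) where
  alloc_measurable a := measurable_const
  price_measurable l := measurable_const
  alloc_nonneg v _ a := by
    dsimp only [postedPrice]
    split_ifs <;> simp
  alloc_sum v _ := by simp [postedPrice]
  price_nonneg v _ l := F.lo_nonneg
  supply := by
    refine Filter.Eventually.of_forall fun v a ha => ?_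
    have : a = fun l => ⟨1, Nat.succ_lt_succ l.pos⟩ := by
      by_contra h
      exact ha (if_neg h)
    simp [this]
  price_integrable l v _ := integrable_const _
  incentive_compatible l v v' _ _ := by simp only [interimUtility_postedPrice, le_refl]
  individually_rational l v hv := by
    rw [interimUtility_postedPrice]
    exact sub_nonneg.mpr ((hv l).1.trans (le_max_left _ _))

theorem le_optimalRevenue_competition (F : ValueDistribution) (n : ℕ) :
    ENNReal.ofReal (n * F.lo) ≤ optimalRevenue F (competition n) n := by
  refine le_trans (le_of_eq ?_) (le_iSup₂ (postedPrice n F.lo) (isBIC_postedPrice_lo F n))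
  simp [revenue, postedPrice, ENNReal.ofReal_mul]

/-- Union bound: buyer `l` pays only if her own valuation reaches `p`; the priority order is
dropped. -/
theorem revenue_bundle_competition_le (F : ValueDistribution) {n : ℕ} (hn : 0 < n) {p : ℝ}
    (hp : 0 < p) :
    revenue F (bundleMechanism (competition n) n p) ≤
      n * (ENNReal.ofReal p * F.law (Ici p)) := by
  have hA (l : Fin n) : MeasurableSet {v : Fin n → ℝ | p ≤ v l} :=
    measurableSet_le measurable_const (measurable_pi_apply l)
  have hP (l : Fin n) : F.profileLaw n {v | p ≤ v l} = F.law (Ici p) :=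
    (F.measurePreserving_eval_profileLaw l).measure_preimage measurableSet_Ici.nullMeasurableSet
  calc revenue F (bundleMechanism (competition n) n p)
      ≤ ∫⁻ v, ∑ l, {v : Fin n → ℝ | p ≤ v l}.indicator (fun _ => ENNReal.ofReal p) v
          ∂F.profileLaw n := by
        refine lintegral_mono fun v => Finset.sum_le_sum fun l _ => ?_
        by_cases hb : buysBundle (competition n) n p v l
        · have h0 := hb.1
          rw [competition_group, surplus_eq_of_card_le (by simpa using Nat.one_le_of_lt hn)] at h0
          have hv : p ≤ v l := by
            -- A non-positive valuation would give surplus `-p < 0`; this is where `0 < p` enters.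
            rcases le_total 0 (v l) with h | h
            · simpa [h] using h0
            · simp [h] at h0
              linarith
          rw [indicator_of_mem (show v ∈ {v : Fin n → ℝ | p ≤ v l} from hv)]
          simp [bundleMechanism, hb]
        · simp [bundleMechanism, hb]
    _ = n * (ENNReal.ofReal p * F.law (Ici p)) := by
        rw [lintegral_finsetSum _ fun l _ => measurable_const.indicator (hA l)]
        simp [lintegral_indicator_const (hA _), hP]

/-! ### Shifted exponential distributions -/

/-- The density of the exponential distribution of rate one, shifted by `s`. -/
noncomputable def shiftedExpPdf (s : ℝ) : ℝ → ℝ :=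
  (Ici s).indicator fun v => Real.exp (s - v)

theorem integrableOn_exp_sub (s p : ℝ) : IntegrableOn (fun v => Real.exp (s - v)) (Ioi p) := by
  simp only [sub_eq_add_neg, Real.exp_add]
  exact (integrableOn_exp_neg_Ioi p).const_mul _

theorem setLIntegral_shiftedExpPdf {s p : ℝ} (h : s ≤ p) :
    ∫⁻ v in Ioi p, ENNReal.ofReal (shiftedExpPdf s v) = ENNReal.ofReal (Real.exp (s - p)) := by
  have : ∫⁻ v in Ioi p, ENNReal.ofReal (shiftedExpPdf s v) =
      ∫⁻ v in Ioi p, ENNReal.ofReal (Real.exp (s - v)) := by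
    refine setLIntegral_congr_fun measurableSet_Ioi fun v hv => ?_
    rw [shiftedExpPdf, indicator_of_mem (show v ∈ Ici s from h.trans (le_of_lt hv))]
  rw [this, ← ofReal_integral_eq_lintegral_ofReal (integrableOn_exp_sub s p)
    (Filter.Eventually.of_forall fun v => (Real.exp_pos _).le)]
  simp only [sub_eq_add_neg, Real.exp_add, integral_const_mul, integral_exp_neg_Ioi]

/-- The exponential distribution of rate one, shifted by `s`. -/
noncomputable def shiftedExp (s : ℝ) (hs : 0 ≤ s) : ValueDistribution where
  lo := s
  hi := ⊤
  pdf := shiftedExpPdf s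
  lo_nonneg := hs
  lo_lt_hi := EReal.coe_lt_top s
  pdf_measurable := (by fun_prop : Measurable fun v => Real.exp (s - v)).indicator measurableSet_Ici
  pdf_pos v hv _ := by
    rw [shiftedExpPdf, indicator_of_mem (show v ∈ Ici s from hv)]
    exact Real.exp_pos _
  pdf_eq_zero v hv := indicator_of_notMem (fun h => hv ⟨h, le_top⟩) _
  lintegral_pdf := by
    have h : (fun v => ENNReal.ofReal (shiftedExpPdf s v)) =
        (Ici s).indicator fun v => ENNReal.ofReal (shiftedExpPdf s v) := by
      ext v
      by_cases hv : v ∈ Ici s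
      · rw [indicator_of_mem hv]
      · rw [indicator_of_notMem hv, shiftedExpPdf, indicator_of_notMem hv, ENNReal.ofReal_zero]
    rw [h, lintegral_indicator measurableSet_Ici, setLIntegral_congr Ioi_ae_eq_Ici.symm,
      setLIntegral_shiftedExpPdf le_rfl]
    simp

section shiftedExp

variable {s : ℝ} {hs : 0 ≤ s}

theorem shiftedExp_law_Ioi {p : ℝ} (h : s ≤ p) :
    (shiftedExp s hs).law (Ioi p) = ENNReal.ofReal (Real.exp (s - p)) := by
  rw [ValueDistribution.law, withDensity_apply _ measurableSet_Ioi]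
  exact setLIntegral_shiftedExpPdf h

theorem shiftedExp_law_Ici {p : ℝ} (h : s ≤ p) :
    (shiftedExp s hs).law (Ici p) = ENNReal.ofReal (Real.exp (s - p)) := by
  have : (shiftedExp s hs).law (Ici p) = (shiftedExp s hs).law (Ioi p) :=
    measure_congr ((withDensity_absolutelyContinuous _ _).ae_le Ioi_ae_eq_Ici.symm)
  rw [this, shiftedExp_law_Ioi h]

/-- Density and survival function coincide on the support, so the function to be monotone is `lam *
v - 1`. -/
theorem shiftedExp_isRegular {lam : ℝ} (hlam : 0 ≤ lam) : (shiftedExp s hs).IsRegular lam := by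
  have key : ∀ v ∈ (shiftedExp s hs).types,
      (1 - ProbabilityTheory.cdf (shiftedExp s hs).law v) / (shiftedExp s hs).pdf v = 1 := by
    intro v hv
    have hsv : s ≤ v := hv.1
    have h1 : 1 - ProbabilityTheory.cdf (shiftedExp s hs).law v = Real.exp (s - v) := by
      rw [ProbabilityTheory.cdf_eq_real, ← probReal_compl_eq_one_sub measurableSet_Iic, compl_Iic,
        measureReal_def, shiftedExp_law_Ioi hsv, ENNReal.toReal_ofReal (Real.exp_pos _).le]
    have h2 : (shiftedExp s hs).pdf v = Real.exp (s - v) := by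
      change shiftedExpPdf s v = _
      rw [shiftedExpPdf, indicator_of_mem (show v ∈ Ici s from hsv)]
    rw [h1, h2, div_self (Real.exp_pos _).ne']
  intro v hv w hw hvw
  dsimp only
  rw [key v hv, key w hw]
  gcongr

theorem shiftedExp_integrable_pow (q : ℕ) :
    Integrable (fun v : ℝ => v ^ q) (shiftedExp s hs).law := by
  rw [ValueDistribution.law, integrable_withDensity_iff
    (shiftedExp s hs).pdf_measurable.ennreal_ofReal (by simp)]
  have h : (fun v => v ^ q * (ENNReal.ofReal ((shiftedExp s hs).pdf v)).toReal) =
      (Ici s).indicator fun v => v ^ q * Real.exp (s - v) := by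
    ext v
    by_cases hv : v ∈ Ici s
    · simp [shiftedExp, shiftedExpPdf, indicator_of_mem hv, (Real.exp_pos _).le]
    · simp [shiftedExp, shiftedExpPdf, indicator_of_notMem hv]
  rw [h, integrable_indicator_iff measurableSet_Ici, integrableOn_Ici_iff_integrableOn_Ioi]
  -- Up to the factor `exp s`, this is the integrand of the Gamma function at `q + 1`.
  have hG : IntegrableOn (fun v : ℝ => Real.exp s * (Real.exp (-v) * v ^ ((q + 1 : ℝ) - 1)))
      (Ioi 0) := (Real.GammaIntegral_convergent (by positivity)).const_mul _
  refine (hG.mono_set (Ioi_subset_Ioi hs)).congr_fun (fun v _ => ?_) measurableSet_Ioi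
  dsimp only
  rw [add_sub_cancel_right, Real.rpow_natCast, sub_eq_add_neg, Real.exp_add]
  ring

/-- Under competition, a bundle whose price is about twice the lowest valuation or more earns less
than the fraction `γ` of the optimal revenue. -/
theorem shiftedExp_revenue_bundle_lt {γ ε₀ p : ℝ} (hγ : 0 < γ) (hsε : ε₀ < s)
    (hsγ : 2 * Real.exp ε₀ < γ * s) (hp : 2 * (s - ε₀) ≤ p) (hsp : s ≤ p)
    {n : ℕ} (hn : 0 < n) :
    revenue (shiftedExp s hs) (bundleMechanism (competition n) n p) <
      ENNReal.ofReal γ * optimalRevenue (shiftedExp s hs) (competition n) n := by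
  have hp0 : 0 < p := by linarith
  have hs0 : 0 < s := by
    by_contra h
    have := Real.exp_pos ε₀
    nlinarith
  have hn' : (0 : ℝ) < n := by exact_mod_cast hn
  have hlt : p * Real.exp (s - p) < γ * s := by
    -- Half of the exponential decay absorbs the factor `p`; the other half, with `p ≥ 2 (s - ε₀)`,
    -- cancels `exp s` up to `exp ε₀`.
    have h1 : p ≤ 2 * Real.exp (p / 2) := by linarith [Real.add_one_le_exp (p / 2)]
    calc p * Real.exp (s - p) ≤ 2 * Real.exp (p / 2) * Real.exp (s - p) := by gcongr
      _ = 2 * Real.exp (s - p / 2) := by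
        rw [mul_assoc, ← Real.exp_add]
        congr 2
        ring
      _ ≤ 2 * Real.exp ε₀ := by gcongr; linarith
      _ < γ * s := hsγ
  calc revenue (shiftedExp s hs) (bundleMechanism (competition n) n p)
      ≤ n * (ENNReal.ofReal p * (shiftedExp s hs).law (Ici p)) :=
        revenue_bundle_competition_le _ hn hp0
    _ = ENNReal.ofReal (n * (p * Real.exp (s - p))) := by
        rw [shiftedExp_law_Ici hsp, ENNReal.ofReal_mul hn'.le, ENNReal.ofReal_mul hp0.le,
          ENNReal.ofReal_natCast]
    _ < ENNReal.ofReal (γ * (n * s)) := by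
        refine (ENNReal.ofReal_lt_ofReal_iff (by positivity)).mpr ?_
        nlinarith
    _ = ENNReal.ofReal γ * ENNReal.ofReal (n * s) := ENNReal.ofReal_mul hγ.le
    _ ≤ _ := by gcongr; exact le_optimalRevenue_competition (shiftedExp s hs) n

end shiftedExp

theorem mainTheorem10 (lam : ℝ) (hlam0 : 0 ≤ lam) (hlam1 : lam < 1)
    (γ : ℝ) (hγ : 0 < γ) (ε₀ : ℝ) (hε₀ : 0 < ε₀) :
    ∃ F : ValueDistribution, F.IsRegular lam ∧
      (∀ q : ℕ, Integrable (fun v : ℝ => v ^ q) F.law) ∧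
      BundleAsymptoticallyOptimal F ∧
      ε₀ < F.mean ∧
      (∀ ε ∈ Ioc 0 ε₀, ∀ n : ℕ, 2 ≤ n →
        revenue F (bundleMechanism (competition n) n (bundlePrice F n ε)) <
          ENNReal.ofReal γ * optimalRevenue F (competition n) n) ∧
      (∀ ε ∈ Ioo 0 F.mean, ∃ N : ℕ, ∀ n : ℕ, N ≤ n →
        revenue F (bundleMechanism (competition n) n (bundlePrice F n ε)) <
          ENNReal.ofReal γ * optimalRevenue F (competition n) n) := by
  -- The term `2 ε₀` gives `2 (s - ε₀) ≥ s`, so the bundle price lies in the support; the other term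
  -- gives `2 exp ε₀ < γ s`.
  obtain ⟨s, hs⟩ : ∃ s : ℝ, 2 * ε₀ + 2 * Real.exp ε₀ / γ < s := exists_gt _
  have hE : 0 < 2 * Real.exp ε₀ / γ := by positivity
  have hsε : 2 * ε₀ < s := by linarith
  have hsγ : 2 * Real.exp ε₀ < γ * s := by
    rw [← div_lt_iff₀' hγ]
    linarith
  have hs0 : 0 ≤ s := by linarith
  have h1 : Integrable (fun v : ℝ => v) (shiftedExp s hs0).law := by
    simpa using shiftedExp_integrable_pow (hs := hs0) 1
  have hm : s ≤ (shiftedExp s hs0).mean := (shiftedExp s hs0).lo_le_mean h1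
  refine ⟨shiftedExp s hs0, shiftedExp_isRegular hlam0, shiftedExp_integrable_pow,
    bundleAsymptoticallyOptimal _ h1 (shiftedExp_integrable_pow 2) (by linarith), by linarith,
    fun ε hε n hn => ?_, fun ε hε => ?_⟩
  · have hn2 : (2 : ℝ) ≤ n := by exact_mod_cast hn
    -- Two buyers suffice, since `E[v] - ε ≥ s - ε₀`.
    have hp : 2 * (s - ε₀) ≤ bundlePrice (shiftedExp s hs0) n ε :=
      mul_le_mul hn2 (by linarith [hε.2]) (by linarith) n.cast_nonneg
    exact shiftedExp_revenue_bundle_lt hγ (by linarith) hsγ hp (by linarith) (by lia)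
  · have hd : 0 < (shiftedExp s hs0).mean - ε := sub_pos.mpr hε.2
    obtain ⟨N, hN⟩ := exists_nat_ge (2 * (s - ε₀) / ((shiftedExp s hs0).mean - ε))
    -- The successor makes `0 < n` immediate.
    refine ⟨N + 1, fun n hn => ?_⟩
    have hp : 2 * (s - ε₀) ≤ bundlePrice (shiftedExp s hs0) n ε := by
      rw [bundlePrice, ← div_le_iff₀ hd]
      exact hN.trans (by exact_mod_cast (Nat.le_succ N).trans hn)
    exact shiftedExp_revenue_bundle_lt hγ (by linarith) hsγ hp (by linarith) (by lia)
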